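/- Let $\alpha>0$ be an ordinal, let $V={}^{\alpha}\mathbb{Q}^{(\mathbf 0)}$ be the set of sequences $s\in{}^{\alpha}\mathbb{Q}$ with $s_i\neq 0$ for only finitely many $i<\alpha$, and let $\mathfrak C$ be the full quasi-polyadic equality set algebra with unit $V$: its elements are all subsets of $V$, its Boolean operations are the set-theoretic ones (complement relative to $V$), and its other operations are, for $i,j<\alpha$ and $X\subseteq V$, the cylindrifications $\mathsf c_iX=\{s\in V:\exists t\in X,\ t_k=s_k\text{ for all }k\neq i\}$, the diagonal elements $\mathsf d_{ij}=\{s\in V:s_i=s_j\}$ and the substitutions $\mathsf s_{[i,j]}X=\{s\in V:s\circ[i,j]\in X\}$, where $[i,j]$ is the transposition interchanging $i$ and $j$. For $k\in\mathbb N$ let $a_k=\{s\in V:\sum_{i<\alpha}s_i=k\}$, and for $n\in\mathbb N$ let $\mathfrak A_n$ be the subalgebra of $\mathfrak C$ generated by $\{a_k:k<2^n\}$. Then for every $n\in\mathbb N$ the algebra $\mathfrak A_n$ is simple (it has exactly two congruences), no set of at most $n$ of its elements generates it, and some set of exactly $n+1$ of its elements generates it. Consequently, for every ordinal $\alpha>0$,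 finite or infinite, there is a simple, finitely generated, representable quasi-polyadic equality algebra of dimension $\alpha$ that is not generated by any single element. Here an algebra is representable if it is isomorphic to a subalgebra of a direct product of full set algebras, that is, of algebras of all subsets of ${}^{\alpha}U$ for sets $U$, with the operations defined as above with ${}^{\alpha}U$ in place of $V$. -/

import Mathlib

universe u v w

namespace QEA

/-- The extra-Boolean operations of a quasi-polyadic equality algebra of dimension `ι`:
cylindrifications `c_i`, diagonal elements `d_ij` and the substitutions `s_[i,j]` along
transpositions. -/
class Ops (ι : Type u) (A : Type v) where
  cyl : ι → A → A
  diag : ι → ι → A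
  subst : ι → ι → A → A

section Set

variable {ι : Type u} {U : Type v}

open Classical in
/-- The set algebra of all subsets of a unit `W ⊆ ^ιU`. Its Boolean operations are those of
the Boolean set algebra `℘(W)`, and the other operations are the relativizations to `W` of
`c_i X = {s | ∃ t ∈ X, t and s agree off i}`, `d_ij = {s | s_i = s_j}` and
`s_[i,j] X = {s | s ∘ [i,j] ∈ X}`. -/
instance setOps (W : Set (ι → U)) : Ops ι (Set W) where
  cyl i X := {s | ∃ t ∈ X, ∀ j, j ≠ i → t.1 j = s.1 j}
  diag i j := {s | s.1 i = s.1 j}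
  subst i j X := {s | ∃ t ∈ X, t.1 = s.1 ∘ Equiv.swap i j}

/-- The weak space `^ιU^(p)`: the sequences that differ from `p` in only finitely many places. -/
def weakSpace (p : ι → U) : Set (ι → U) := {s | {i | s i ≠ p i}.Finite}

end Set

/-- Direct products. -/
instance piOps {ι : Type u} {J : Type v} (A : J → Type w) [∀ j, Ops ι (A j)] :
    Ops ι (∀ j, A j) where
  cyl i x := fun j => Ops.cyl i (x j)
  diag i k := fun _ => Ops.diag i k
  subst i k x := fun j => Ops.subst i k (x j)

section Algebra

variable (ι : Type u) {A : Type v} [BooleanAlgebra A] [Ops ι A]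

/-- Membership in the subalgebra generated by `X`. -/
inductive InSg (X : Set A) : A → Prop
  | basic {x : A} : x ∈ X → InSg X x
  | bot : InSg X ⊥
  | sup {x y : A} : InSg X x → InSg X y → InSg X (x ⊔ y)
  | compl {x : A} : InSg X x → InSg X xᶜ
  | cyl (i : ι) {x : A} : InSg X x → InSg X (Ops.cyl i x)
  | diag (i j : ι) : InSg X (Ops.diag i j)
  | subst (i j : ι) {x : A} : InSg X x → InSg X (Ops.subst i j x)

variable (A) in
/-- Subalgebras. -/
structure Subalgebra extends BooleanSubalgebra A where
  cyl_mem' : ∀ (i : ι) {x : A}, x ∈ carrier → Ops.cyl i x ∈ carrier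
  diag_mem' : ∀ i j : ι, (Ops.diag i j : A) ∈ carrier
  subst_mem' : ∀ (i j : ι) {x : A}, x ∈ carrier → Ops.subst i j x ∈ carrier

/-- The subalgebra generated by `X`. -/
def Sg (X : Set A) : Subalgebra ι A where
  carrier := {x | InSg ι X x}
  supClosed' := fun _ hx _ hy => InSg.sup hx hy
  infClosed' := fun x hx y hy => by
    have h : InSg ι X (xᶜ ⊔ yᶜ)ᶜ := (InSg.sup hx.compl hy.compl).compl
    simpa using h
  compl_mem' := fun hx => InSg.compl hx
  bot_mem' := InSg.bot
  cyl_mem' := fun i _ hx => InSg.cyl i hx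
  diag_mem' := fun i j => InSg.diag i j
  subst_mem' := fun i j _ hx => InSg.subst i j hx

/-- The underlying type of a subalgebra. -/
abbrev Subalgebra.Carrier {ι : Type u} {A : Type v} [BooleanAlgebra A] [Ops ι A]
    (S : Subalgebra ι A) : Type v := S.toBooleanSubalgebra

/-- A subalgebra is an algebra under the restricted operations
(the Boolean part is Mathlib's structure on a Boolean subalgebra). -/
instance subalgebraOps {ι : Type u} {A : Type v} [BooleanAlgebra A] [Ops ι A]
    (S : Subalgebra ι A) : Ops ι S.Carrier where
  cyl i x := ⟨Ops.cyl i x.1, S.cyl_mem' i x.2⟩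
  diag i j := ⟨Ops.diag i j, S.diag_mem' i j⟩
  subst i j x := ⟨Ops.subst i j x.1, S.subst_mem' i j x.2⟩

/-- `X` generates the whole algebra. -/
def Generates (X : Set A) : Prop := ∀ a : A, InSg ι X a

/-- Congruences. -/
structure IsCongruence (r : Setoid A) : Prop where
  sup : ∀ {x x' y y' : A}, r x x' → r y y' → r (x ⊔ y) (x' ⊔ y')
  inf : ∀ {x x' y y' : A}, r x x' → r y y' → r (x ⊓ y) (x' ⊓ y')
  compl : ∀ {x x' : A}, r x x' → r xᶜ x'ᶜ
  cyl : ∀ (i : ι) {x x' : A}, r x x' → r (Ops.cyl i x) (Ops.cyl i x')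
  subst : ∀ (i j : ι) {x x' : A}, r x x' → r (Ops.subst i j x) (Ops.subst i j x')

variable (A) in
/-- An algebra is simple if it has exactly two congruences, the identity `⊥` and the
total relation `⊤`. -/
def IsSimple : Prop :=
  Nontrivial A ∧ ∀ r : Setoid A, IsCongruence ι r → r = ⊥ ∨ r = ⊤

/-- Homomorphisms. -/
structure IsHom {B : Type w} [BooleanAlgebra B] [Ops ι B] (f : A → B) : Prop where
  bot : f ⊥ = ⊥
  top : f ⊤ = ⊤
  sup : ∀ x y, f (x ⊔ y) = f x ⊔ f y
  inf : ∀ x y, f (x ⊓ y) = f x ⊓ f y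
  compl : ∀ x, f xᶜ = (f x)ᶜ
  cyl : ∀ (i : ι) (x : A), f (Ops.cyl i x) = Ops.cyl i (f x)
  diag : ∀ i j : ι, f (Ops.diag i j) = Ops.diag i j
  subst : ∀ (i j : ι) (x : A), f (Ops.subst i j x) = Ops.subst i j (f x)

end Algebra

/-- Representable quasi-polyadic equality algebras of dimension `ι`: the algebras that embed
into a product of full set algebras with units `^ιU`. -/
def IsRepresentable (ι A : Type u) [BooleanAlgebra A] [Ops ι A] : Prop :=
  ∃ (J : Type u) (U : J → Type u)
    (f : A → ∀ j, Set (Set.univ : Set (ι → U j))),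
    IsHom ι f ∧ Function.Injective f

section Rational

variable (ι : Type u)

/-- The weak space `V = ^ιℚ^(0)` of finitely supported sequences of rationals. -/
abbrev V : Set (ι → ℚ) := weakSpace (fun _ => 0)

/-- The full set algebra on `V`. -/
abbrev C : Type u := Set (V ι)

variable {ι} in
/-- The hyperplane `[t, r] = {s ∈ V | t = ∑ r_i s_i}`. The sum has finitely many nonzero
terms, since `s` is finitely supported. -/
def hyperplane (t : ℚ) (r : ι → ℚ) : C ι := {s | t = ∑ᶠ i, r i * s.1 i}

/-- `a_k = [k, 1]`, where `1` is the constant sequence. -/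
def a (k : ℕ) : C ι := hyperplane (k : ℚ) (fun _ => 1)

/-- `A_n`, the subalgebra of the full set algebra on `V` generated by the `a_k`, `k < 2 ^ n`. -/
def subalg (n : ℕ) : Subalgebra ι (C ι) := Sg ι {x | ∃ k < 2 ^ n, x = a ι k}

/-- The algebra `A_n`. -/
abbrev Alg (n : ℕ) : Type u := (subalg ι n).Carrier

end Rational

end QEA

/-! By quantifier elimination over ℚ, every element of `Alg ι n` is a Boolean combination of
finitely many affine hyperplanes of V. Eliminating the variable i leaves functionals with
coefficient 0 at i. Such a functional is zero or skew, hence never a nonzero multiple of `total`, so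
the only level planes `total = k` ever needed are the generating ones, k < 2 ^ n (`good_of_inSg`).

Simplicity: finitely many functionals factor through a finite-dimensional space, so finitely many
cylindrifications take a nonzero element to ⊤ (`exists_foldr_cyl_eq_top`).

Lower bound: on each level an element contains all sufficiently generic points or none. Cylinders
and diagonals do not distinguish the generic points of different levels, and the remaining
operations cannot separate two levels that no generator separates (`balanced_of_inSg`). With at most
n generators, two of the 2 ^ n + 1 levels 0, ..., 2 ^ n stay unseparated, yet `a` of the smaller one
separates them.

Upper bound: n + 1 unions of the `a ι k`, chosen by binary digits, recover each `a ι k`.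

Representability: truncating sequences over an ultrapower of ℚ to finite index sets gives a
homomorphism into a full set algebra, which is injective by simplicity. -/

namespace QEA

/-! ### Operations in terms of finitely supported vectors -/

section WeakSpace

variable {ι : Type u}

/-- A finitely supported function as a point of the weak space. -/
def toV (s : ι →₀ ℚ) : V ι := ⟨s, s.hasFiniteSupport⟩

theorem toV_surjective : Function.Surjective (toV (ι := ι)) := fun v =>
  ⟨Finsupp.ofSupportFinite v.1 v.2, rfl⟩

theorem set_ext {X Y : C ι} (h : ∀ s, toV s ∈ X ↔ toV s ∈ Y) : X = Y := by
  ext v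
  obtain ⟨s, rfl⟩ := toV_surjective v
  exact h s

theorem toV_mem_cyl (i : ι) (X : C ι) (s : ι →₀ ℚ) :
    toV s ∈ (Ops.cyl i X : C ι) ↔ ∃ q, toV (s + Finsupp.single i q) ∈ X := by
  classical
  constructor
  · rintro ⟨t, ht, hts⟩
    obtain ⟨t, rfl⟩ := toV_surjective t
    refine ⟨t i - s i, ?_⟩
    convert ht using 2
    ext j
    by_cases hj : j = i
    · subst hj; simp
    · have := hts j hj
      simp only [toV] at this
      simp [Ne.symm hj, this]
  · rintro ⟨q, hq⟩
    exact ⟨_, hq, fun j hj => by simp [toV, Ne.symm hj]⟩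

open Classical in
/-- The action of a transposition of coordinates. -/
noncomputable def swapMap (i j : ι) : (ι →₀ ℚ) →ₗ[ℚ] (ι →₀ ℚ) :=
  (Finsupp.domLCongr (Equiv.swap i j)).toLinearMap

open Classical in
theorem swapMap_single (i j k : ι) (q : ℚ) :
    swapMap i j (Finsupp.single k q) = Finsupp.single (Equiv.swap i j k) q := by
  simp [swapMap]

theorem toV_mem_subst (i j : ι) (X : C ι) (s : ι →₀ ℚ) :
    toV s ∈ (Ops.subst i j X : C ι) ↔ toV (swapMap i j s) ∈ X := by
  classical
  have key : (toV (swapMap i j s)).1 = (toV s).1 ∘ Equiv.swap i j := by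
    ext k
    simp [toV, swapMap, Finsupp.domLCongr_apply, Finsupp.domCongr_apply,
      Finsupp.equivMapDomain_apply]
  constructor
  · rintro ⟨t, ht, hts⟩
    have : toV (swapMap i j s) = t := Subtype.ext (key.trans (by convert hts.symm))
    rwa [this]
  · intro h
    exact ⟨_, h, by convert key⟩

/-- The sum of the coordinates. -/
noncomputable def total (ι : Type u) : Module.Dual ℚ (ι →₀ ℚ) :=
  Finsupp.linearCombination ℚ (fun _ => 1)

@[simp]
theorem total_single (i : ι) (q : ℚ) : total ι (Finsupp.single i q) = q := by
  simp [total]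

theorem toV_mem_a (k : ℕ) (s : ι →₀ ℚ) : toV s ∈ a ι k ↔ total ι s = k := by
  have : ∑ᶠ i, 1 * (toV s).1 i = total ι s := by
    simp only [toV, total, Finsupp.linearCombination_apply, one_mul, smul_eq_mul, mul_one]
    rw [finsum_eq_sum_of_support_subset (s := s.support) _ (by simp)]
    rfl
  show (k : ℚ) = ∑ᶠ i, 1 * (toV s).1 i ↔ _
  rw [this, eq_comm]

end WeakSpace

/-! ### Quantifier elimination for hyperplanes -/

section Determined

variable {ι : Type u}

/-- An affine hyperplane `φ = t`, coded as `(t, φ)`. -/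
abbrev Plane (ι : Type u) := ℚ × Module.Dual ℚ (ι →₀ ℚ)

/-- Membership in `X` depends only on which planes of `T` a point lies on. -/
def Determines (T : Set (Plane ι)) (X : C ι) : Prop :=
  ∀ s s' : ι →₀ ℚ, (∀ h ∈ T, h.2 s = h.1 ↔ h.2 s' = h.1) → toV s ∈ X → toV s' ∈ X

theorem Determines.mono {T T' : Set (Plane ι)} {X : C ι} (h : Determines T X) (hT : T ⊆ T') :
    Determines T' X := fun s s' hs => h s s' fun p hp => hs p (hT hp)

theorem Determines.iff {T : Set (Plane ι)} {X : C ι} (h : Determines T X) {s s' : ι →₀ ℚ}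
    (hs : ∀ h ∈ T, h.2 s = h.1 ↔ h.2 s' = h.1) : toV s ∈ X ↔ toV s' ∈ X :=
  ⟨h s s' hs, h s' s fun p hp => (hs p hp).symm⟩

theorem Determines.compl {T : Set (Plane ι)} {X : C ι} (h : Determines T X) :
    Determines T Xᶜ := fun _ _ hs hX => fun hX' => hX ((h.iff hs).2 hX')

theorem Determines.sup {T : Set (Plane ι)} {X Y : C ι} (hX : Determines T X)
    (hY : Determines T Y) : Determines T (X ⊔ Y) := fun s s' hs h =>
  h.elim (fun h => Or.inl (hX s s' hs h)) fun h => Or.inr (hY s s' hs h)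

/-- The value of the functional on the `i`-th basis vector. -/
noncomputable def Plane.coeff (h : Plane ι) (i : ι) : ℚ := h.2 (Finsupp.single i 1)

theorem Plane.apply_add_single (h : Plane ι) (s : ι →₀ ℚ) (i : ι) (q : ℚ) :
    h.2 (s + Finsupp.single i q) = h.2 s + q * h.coeff i := by
  have : Finsupp.single i q = q • Finsupp.single i (1 : ℚ) := by simp
  rw [map_add, this, map_smul, smul_eq_mul, Plane.coeff]

/-- The plane obtained from `h` and `h'` by eliminating the variable `i`. -/
noncomputable def Plane.elim (i : ι) (h h' : Plane ι) : Plane ι :=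
  ((h.coeff i)⁻¹ * h.1 - (h'.coeff i)⁻¹ * h'.1,
    (h.coeff i)⁻¹ • h.2 - (h'.coeff i)⁻¹ • h'.2)

/-- All planes obtained from `T` by eliminating the variable `i`. -/
noncomputable def eliminate (i : ι) (T : Set (Plane ι)) : Set (Plane ι) :=
  {h ∈ T | h.coeff i = 0} ∪
    Set.image2 (Plane.elim i) {h ∈ T | h.coeff i ≠ 0} {h ∈ T | h.coeff i ≠ 0}

theorem eliminate_finite (i : ι) {T : Set (Plane ι)} (hT : T.Finite) :
    (eliminate i T).Finite :=
  (hT.subset (Set.sep_subset _ _)).union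
    ((hT.subset (Set.sep_subset _ _)).image2 _ (hT.subset (Set.sep_subset _ _)))

theorem coeff_of_mem_eliminate {i : ι} {T : Set (Plane ι)} {h : Plane ι}
    (hh : h ∈ eliminate i T) : h.coeff i = 0 := by
  rcases hh with hh | ⟨p, ⟨-, hp⟩, p', ⟨-, hp'⟩, rfl⟩
  · exact hh.2
  · simp only [Plane.coeff, Plane.elim, LinearMap.sub_apply, LinearMap.smul_apply,
      smul_eq_mul] at *
    rw [inv_mul_cancel₀ hp, inv_mul_cancel₀ hp', sub_self]

/-- Quantifier elimination. -/
theorem Determines.cyl {T : Set (Plane ι)} {X : C ι} (hX : Determines T X) (hT : T.Finite)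
    (i : ι) : Determines (eliminate i T) (Ops.cyl i X) := by
  intro s s' hs hsX
  rw [toV_mem_cyl] at hsX ⊢
  obtain ⟨q, hq⟩ := hsX
  have flat : ∀ h ∈ T, h.coeff i = 0 → (h.2 s = h.1 ↔ h.2 s' = h.1) := fun h hh h0 =>
    hs h (Or.inl ⟨hh, h0⟩)
  -- If the witness for s lies on a plane h that is not flat in direction i, the witness for s' is
  -- put on the same h. Otherwise it only has to avoid all non-flat planes.
  by_cases hex : ∃ h ∈ T, h.coeff i ≠ 0 ∧ h.2 (s + Finsupp.single i q) = h.1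
  · obtain ⟨h, hh, h0, hon⟩ := hex
    refine ⟨(h.1 - h.2 s') / h.coeff i, hX _ _ ?_ hq⟩
    intro p hp
    rw [Plane.apply_add_single] at hon ⊢
    rw [Plane.apply_add_single]
    by_cases p0 : p.coeff i = 0
    · simpa [p0] using flat p hp p0
    -- Along h, lying on p is equivalent to lying on the plane that eliminates i from p and h, and
    -- there s and s' agree.
    · have key := hs _ (Or.inr ⟨p, ⟨hp, p0⟩, h, ⟨hh, h0⟩, rfl⟩)
      simp only [Plane.elim, LinearMap.sub_apply, LinearMap.smul_apply, smul_eq_mul] at key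
      have e : ∀ (t : ι →₀ ℚ) (c : ℚ), h.2 t + c * h.coeff i = h.1 →
          (p.2 t + c * p.coeff i = p.1 ↔
            (p.coeff i)⁻¹ * p.2 t - (h.coeff i)⁻¹ * h.2 t =
              (p.coeff i)⁻¹ * p.1 - (h.coeff i)⁻¹ * h.1) := by
        intro t c hc
        rw [← hc]
        field_simp
        exact ⟨fun H => by linear_combination h.coeff i * H,
          fun H => mul_left_cancel₀ h0 (by linear_combination H)⟩
      rw [e s q hon, e s' _ (by field_simp; ring), key]
  · push Not at hex
    -- Each non-flat plane meets the line through s' once, so a rational outside finitely many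
    -- values misses them all.
    obtain ⟨q', hq'⟩ := (hT.image fun h => (h.1 - h.2 s') / h.coeff i).exists_notMem
    refine ⟨q', hX _ _ ?_ hq⟩
    intro p hp
    by_cases p0 : p.coeff i = 0
    · simpa [Plane.apply_add_single, p0] using flat p hp p0
    · refine iff_of_false (hex p hp p0) fun H => hq' ⟨p, hp, ?_⟩
      rw [Plane.apply_add_single] at H
      rw [div_eq_iff p0]
      linarith

/-- The plane is not parallel to the planes `total = k`. -/
def Plane.Skew (h : Plane ι) : Prop := ∃ i j, h.coeff i ≠ h.coeff j

/-- Permuting the coordinates of a plane. -/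
noncomputable def Plane.swap (i j : ι) (h : Plane ι) : Plane ι := (h.1, h.2 ∘ₗ swapMap i j)

theorem Determines.subst {T : Set (Plane ι)} {X : C ι} (hX : Determines T X) (i j : ι) :
    Determines (Plane.swap i j '' T) (Ops.subst i j X) := by
  intro s s' hs h
  rw [toV_mem_subst] at h ⊢
  exact hX _ _ (fun p hp => hs _ ⟨p, hp, rfl⟩) h

open Classical in
theorem Plane.swap_coeff (i j k : ι) (h : Plane ι) :
    (h.swap i j).coeff k = h.coeff (Equiv.swap i j k) := by
  simp [Plane.swap, Plane.coeff, swapMap_single]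

theorem Plane.Skew.swap {h : Plane ι} (hh : h.Skew) (i j : ι) : (h.swap i j).Skew := by
  classical
  obtain ⟨k, l, hkl⟩ := hh
  refine ⟨Equiv.swap i j k, Equiv.swap i j l, ?_⟩
  simpa [Plane.swap_coeff] using hkl

theorem total_comp_swapMap (i j : ι) : total ι ∘ₗ swapMap i j = total ι := by
  classical
  ext k
  simp [swapMap_single]

theorem Plane.eq_zero_or_skew {h : Plane ι} {i : ι} (hi : h.coeff i = 0) :
    h.2 = 0 ∨ h.Skew := by
  by_contra! H
  refine H.1 ?_
  ext j
  have : h.coeff j = 0 := by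
    by_contra hj
    exact H.2 ⟨j, i, by rwa [hi]⟩
  simpa [Plane.coeff] using this

/-- The planes that occur in the description of elements of `A_n`. -/
def planes (ι : Type u) (n : ℕ) : Set (Plane ι) :=
  {h | h.2 = 0 ∨ (∃ k : ℕ, k < 2 ^ n ∧ h = ((k : ℚ), total ι)) ∨ h.Skew}

/-- `X` is a finite Boolean combination of planes of `planes ι n`. -/
def Good (n : ℕ) (X : C ι) : Prop := ∃ T ⊆ planes ι n, T.Finite ∧ Determines T X

/-- This holds for arbitrary T: `total` has coefficient 1 at every coordinate, so elimination never
produces a new level plane. -/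
theorem eliminate_subset_planes (n : ℕ) (i : ι) (T : Set (Plane ι)) :
    eliminate i T ⊆ planes ι n := fun _ hh =>
  (Plane.eq_zero_or_skew (coeff_of_mem_eliminate hh)).imp_right Or.inr

/-- The plane `s i = s j`. -/
noncomputable def diagPlane (i j : ι) : Plane ι := (0, Finsupp.lapply i - Finsupp.lapply j)

theorem determines_diag (i j : ι) : Determines {diagPlane i j} (Ops.diag i j) := by
  intro s s' hs h
  have := hs _ rfl
  simp only [diagPlane, LinearMap.sub_apply, Finsupp.lapply_apply, sub_eq_zero] at this
  exact this.1 h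

theorem diagPlane_eq_zero_or_skew (i j : ι) : (diagPlane i j).2 = 0 ∨ (diagPlane i j).Skew := by
  classical
  by_cases h : i = j
  · left; simp [diagPlane, h]
  · refine Or.inr ⟨i, j, ?_⟩
    simp only [Plane.coeff, diagPlane, LinearMap.sub_apply, Finsupp.lapply_apply,
      Finsupp.single_apply, h, Ne.symm h, if_true, if_false]
    norm_num

theorem good_of_inSg {n : ℕ} {X : C ι} (hX : InSg ι {x | ∃ k < 2 ^ n, x = a ι k} X) :
    Good n X := by
  induction hX with
  | basic h =>
    obtain ⟨k, hk, rfl⟩ := h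
    refine ⟨{((k : ℚ), total ι)}, ?_, Set.finite_singleton _, ?_⟩
    · rintro _ rfl
      exact Or.inr (Or.inl ⟨k, hk, rfl⟩)
    · intro s s' hs h
      rw [toV_mem_a] at h ⊢
      exact (hs _ rfl).1 h
  | bot => exact ⟨∅, Set.empty_subset _, Set.finite_empty, fun _ _ _ h => h⟩
  | sup _ _ h₁ h₂ =>
    obtain ⟨T, hT, fT, dT⟩ := h₁
    obtain ⟨S, hS, fS, dS⟩ := h₂
    exact ⟨T ∪ S, Set.union_subset hT hS, fT.union fS,
      (dT.mono Set.subset_union_left).sup (dS.mono Set.subset_union_right)⟩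
  | compl _ h =>
    obtain ⟨T, hT, fT, dT⟩ := h
    exact ⟨T, hT, fT, dT.compl⟩
  | cyl i _ h =>
    obtain ⟨T, hT, fT, dT⟩ := h
    exact ⟨_, eliminate_subset_planes n i T, eliminate_finite i fT, dT.cyl fT i⟩
  | diag i j =>
    refine ⟨_, ?_, Set.finite_singleton _, determines_diag i j⟩
    rintro _ rfl
    exact (diagPlane_eq_zero_or_skew i j).imp_right Or.inr
  | subst i j _ h =>
    obtain ⟨T, hT, fT, dT⟩ := h
    refine ⟨_, ?_, fT.image _, dT.subst i j⟩
    rintro _ ⟨p, hp, rfl⟩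
    rcases hT hp with h | ⟨k, hk, rfl⟩ | h
    · left; simp [Plane.swap, h]
    · exact Or.inr (Or.inl ⟨k, hk, by simp [Plane.swap, total_comp_swapMap]⟩)
    · exact Or.inr (Or.inr (h.swap i j))

end Determined

/-! ### Simplicity -/

section Simple

variable {ι : Type u}

theorem toV_mem_foldr_cyl (l : List ι) (X : C ι) (s u : ι →₀ ℚ) (hu : ∀ i, u i ≠ 0 → i ∈ l)
    (h : toV (s + u) ∈ X) : toV s ∈ l.foldr Ops.cyl X := by
  classical
  induction l generalizing s u with
  | nil =>
    have : u = 0 := by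
      ext i
      by_contra hi
      exact List.not_mem_nil (hu i hi)
    simpa [this] using h
  | cons i l ih =>
    rw [List.foldr_cons, toV_mem_cyl]
    refine ⟨u i, ih _ (u.erase i) ?_ ?_⟩
    · intro j hj
      have hji : j ≠ i := by
        rintro rfl
        simp at hj
      rw [Finsupp.erase_ne hji] at hj
      exact (List.mem_cons.1 (hu j hj)).resolve_left hji
    · rwa [add_assoc, Finsupp.single_add_erase]

/-- The images of the unit vectors span the range of L, and finitely many of them suffice because W
is finite-dimensional. -/
theorem exists_finset_map_eq {W : Type*} [AddCommGroup W] [Module ℚ W] [FiniteDimensional ℚ W]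
    (L : (ι →₀ ℚ) →ₗ[ℚ] W) :
    ∃ F : Finset ι, ∀ s, ∃ u : ι →₀ ℚ, (∀ i, u i ≠ 0 → i ∈ F) ∧ L u = L s := by
  classical
  let e : ι → W := fun i => L (Finsupp.single i 1)
  obtain ⟨S, hS, hspan⟩ := (Submodule.fg_span_iff_fg_span_finset_subset (Set.range e)).1
    (IsNoetherian.noetherian (Submodule.span ℚ (Set.range e)))
  obtain ⟨F, hF⟩ : ∃ F : Finset ι, F.image e = S := by
    obtain ⟨F, -, hF⟩ := Finset.subset_set_image_iff.1
      (by simpa using hS : (S : Set W) ⊆ e '' Set.univ)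
    exact ⟨F, hF⟩
  refine ⟨F, fun s => ?_⟩
  have hs : L s ∈ Submodule.span ℚ (Set.range e) := by
    induction s using Finsupp.induction_linear with
    | zero => simp
    | add f g hf hg => rw [map_add]; exact add_mem hf hg
    | single i q =>
      have : Finsupp.single i q = q • Finsupp.single i (1 : ℚ) := by simp
      rw [this, map_smul]
      exact Submodule.smul_mem _ _ (Submodule.subset_span ⟨i, rfl⟩)
  rw [hspan, ← hF, Finset.coe_image] at hs
  have himg : e '' (F : Set ι) = L '' ((fun i => Finsupp.single i (1 : ℚ)) '' (F : Set ι)) := by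
    rw [Set.image_image]
  rw [himg, ← Submodule.map_span, ← Finsupp.supported_eq_span_single] at hs
  obtain ⟨u, hu, hus⟩ := hs
  exact ⟨u, fun i hi => hu (by simpa using hi), hus⟩

theorem exists_foldr_cyl_eq_top {T : Set (Plane ι)} (hT : T.Finite) {X : C ι}
    (hX : Determines T X) (hne : X ≠ ⊥) : ∃ l : List ι, l.foldr Ops.cyl X = ⊤ := by
  have := hT.fintype
  obtain ⟨v, hv⟩ := Set.nonempty_iff_ne_empty.2 hne
  obtain ⟨s, rfl⟩ := toV_surjective v
  obtain ⟨F, hF⟩ := exists_finset_map_eq (LinearMap.pi fun h : T => h.1.2)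
  refine ⟨F.toList, set_ext fun s' => iff_of_true ?_ trivial⟩
  -- The correction u is supported in F and has the same values as s - s' on all functionals of T,
  -- so s' + u lies on the same planes of T as s.
  obtain ⟨u, hu, hL⟩ := hF (s - s')
  refine toV_mem_foldr_cyl _ _ _ u (by simpa using hu) (hX s _ (fun h hh => ?_) hv)
  have := congrFun hL ⟨h, hh⟩
  simp only [LinearMap.pi_apply, map_sub] at this
  rw [map_add, this, add_sub_cancel]

theorem coe_foldr_cyl {n : ℕ} (l : List ι) (x : Alg ι n) :
    ((l.foldr Ops.cyl x : Alg ι n) : C ι) = l.foldr Ops.cyl (x : C ι) := by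
  induction l with
  | nil => rfl
  | cons i l ih =>
    rw [List.foldr_cons, List.foldr_cons, ← ih]
    rfl

theorem foldr_cyl_bot {n : ℕ} (l : List ι) : (l.foldr Ops.cyl ⊥ : Alg ι n) = ⊥ := by
  induction l with
  | nil => rfl
  | cons i l ih =>
    rw [List.foldr_cons, ih]
    refine Subtype.ext (set_ext fun s => iff_of_false ?_ id)
    rintro ⟨t, ht, -⟩
    exact ht

theorem IsCongruence.foldr_cyl {A : Type v} [BooleanAlgebra A] [Ops ι A] {r : Setoid A}
    (hr : IsCongruence ι r) (l : List ι) {x y : A} (h : r x y) :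
    r (l.foldr Ops.cyl x) (l.foldr Ops.cyl y) := by
  induction l with
  | nil => exact h
  | cons i l ih => exact hr.cyl i ih

theorem isSimple_alg (ι : Type u) (n : ℕ) : IsSimple ι (Alg ι n) := by
  constructor
  · refine ⟨⊥, ⊤, fun h => ?_⟩
    have h' : toV (0 : ι →₀ ℚ) ∈ ((⊥ : Alg ι n) : C ι) := by
      rw [h]; exact trivial
    exact h'
  · intro r hr
    have top_of : ∀ z : Alg ι n, z ≠ ⊥ → r z ⊥ → r = ⊤ := by
      intro z hz hrz
      obtain ⟨T, -, fT, dT⟩ := good_of_inSg z.2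
      obtain ⟨l, hl⟩ := exists_foldr_cyl_eq_top fT dT fun h => hz (Subtype.ext h)
      have h := hr.foldr_cyl l hrz
      rw [foldr_cyl_bot, show (l.foldr Ops.cyl z : Alg ι n) = ⊤ from
        Subtype.ext ((coe_foldr_cyl l z).trans hl)] at h
      have all : ∀ w, r w ⊥ := fun w => by
        simpa using hr.inf (r.refl' w) h
      exact Setoid.eq_top_iff.2 fun x y => r.trans' (all x) (r.symm' (all y))
    by_contra! H
    refine H.1 (Setoid.ext fun x y => ⟨fun hxy => ?_, fun hxy => ?_⟩)
    · by_contra hne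
      have h₁ : r (x ⊓ yᶜ) ⊥ := by simpa using hr.inf hxy (r.refl' yᶜ)
      have h₂ : r (y ⊓ xᶜ) ⊥ := by simpa using hr.inf (r.symm' hxy) (r.refl' xᶜ)
      have e₁ : x ⊓ yᶜ = ⊥ := by
        by_contra h
        exact H.2 (top_of _ h h₁)
      have e₂ : y ⊓ xᶜ = ⊥ := by
        by_contra h
        exact H.2 (top_of _ h h₂)
      exact hne (le_antisymm (by rwa [← sdiff_eq, sdiff_eq_bot_iff] at e₁)
        (by rwa [← sdiff_eq, sdiff_eq_bot_iff] at e₂))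
    · have : x = y := hxy
      rw [this]

theorem IsSimple.injective_of_isHom {A : Type v} [BooleanAlgebra A] [Ops ι A] {B : Type w}
    [BooleanAlgebra B] [Ops ι B] [Nontrivial B] (hA : IsSimple ι A) {f : A → B}
    (hf : IsHom ι f) : Function.Injective f := by
  have hr : IsCongruence ι (Setoid.ker f) :=
    { sup := fun h₁ h₂ => by simp_all [Setoid.ker_def, hf.sup]
      inf := fun h₁ h₂ => by simp_all [Setoid.ker_def, hf.inf]
      compl := fun h => by simp_all [Setoid.ker_def, hf.compl]
      cyl := fun i _ _ h => by simp_all [Setoid.ker_def, hf.cyl]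
      subst := fun i j _ _ h => by simp_all [Setoid.ker_def, hf.subst] }
  rcases hA.2 _ hr with h | h
  · exact Setoid.injective_iff_ker_bot f |>.2 h
  · have : f ⊥ = f ⊤ := Setoid.eq_top_iff.1 h ⊥ ⊤
    rw [hf.bot, hf.top] at this
    exact absurd this bot_ne_top

end Simple

/-! ### Generic points and the lower bound on generators -/

section LowerBound

variable {ι : Type u}

/-- `p` lies on `total = k` and on no skew plane of `T`. -/
def Generic (k : ℕ) (T : Set (Plane ι)) (p : ι →₀ ℚ) : Prop :=
  total ι p = k ∧ ∀ h ∈ T, h.Skew → h.2 p ≠ h.1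

theorem Generic.mono {k : ℕ} {T T' : Set (Plane ι)} {p : ι →₀ ℚ} (h : Generic k T' p)
    (hT : T ⊆ T') : Generic k T p := ⟨h.1, fun q hq => h.2 q (hT hq)⟩

theorem exists_generic [Nonempty ι] (k : ℕ) {T : Set (Plane ι)} (hT : T.Finite) :
    ∃ p, Generic k T p := by
  induction T, hT using Set.Finite.induction_on with
  | empty =>
    obtain ⟨i⟩ := ‹Nonempty ι›
    exact ⟨Finsupp.single i k, by simp, by simp⟩
  | @insert h T _ hT ih =>
    obtain ⟨p, hp, hpT⟩ := ih
    by_cases hh : h.Skew ∧ h.2 p = h.1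
    · obtain ⟨⟨i, j, hij⟩, hon⟩ := hh
      -- The direction d stays inside the level plane but is transverse to h. A small-support move c
      -- • d with c ≠ 0 leaves h, and c avoids the finitely many values at which other planes would
      -- be met.
      let d : ι →₀ ℚ := Finsupp.single i 1 - Finsupp.single j 1
      have hd : h.2 d ≠ 0 := by
        simpa [d, sub_eq_zero, Plane.coeff] using hij
      obtain ⟨c, hc⟩ :=
        ((hT.image fun q => (q.1 - q.2 p) / q.2 d).union (Set.finite_singleton 0)).exists_notMem
      simp only [Set.mem_union, Set.mem_singleton_iff, not_or] at hc
      refine ⟨p + c • d, by simp [d, hp], ?_⟩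
      rintro q (rfl | hq) hsk
      · simp [hon, hd, hc.2]
      · intro H
        simp only [map_add, map_smul, smul_eq_mul] at H
        by_cases h0 : q.2 d = 0
        · exact hpT q hq hsk (by simpa [h0] using H)
        · exact hc.1 ⟨q, hq, by rw [div_eq_iff h0]; linarith⟩
    · refine ⟨p, hp, ?_⟩
      rintro q (rfl | hq) hsk
      · exact fun H => hh ⟨hsk, H⟩
      · exact hpT q hq hsk

/-- A zero-one law on each level: the planes with zero functional and the level planes are decided
by k alone, and generic points miss the skew ones. -/
theorem Determines.iff_of_generic {n k : ℕ} {T : Set (Plane ι)} {X : C ι}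
    (hX : Determines T X) (hT : T ⊆ planes ι n) {p q : ι →₀ ℚ} (hp : Generic k T p)
    (hq : Generic k T q) : toV p ∈ X ↔ toV q ∈ X := by
  refine hX.iff fun h hh => ?_
  rcases hT hh with h0 | ⟨l, -, rfl⟩ | hsk
  · simp [h0]
  · simp only [hp.1, hq.1]
  · exact iff_of_false (hp.2 h hh hsk) (hq.2 h hh hsk)

/-- Generic points of `total = k` and of `total = l` are not separated by `X`. -/
def Balanced (k l : ℕ) (X : C ι) : Prop :=
  ∃ T : Set (Plane ι), T.Finite ∧
    ∀ p q, Generic k T p → Generic l T q → (toV p ∈ X ↔ toV q ∈ X)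

theorem Determines.balanced {k l : ℕ} {T : Set (Plane ι)} {X : C ι} (hX : Determines T X)
    (fT : T.Finite) (hT : ∀ h ∈ T, h.2 = 0 ∨ h.Skew) : Balanced k l X := by
  refine ⟨T, fT, fun p q hp hq => hX.iff fun h hh => ?_⟩
  rcases hT h hh with h0 | hsk
  · simp [h0]
  · exact iff_of_false (hp.2 h hh hsk) (hq.2 h hh hsk)

theorem Generic.swapMap {k : ℕ} {T : Set (Plane ι)} {i j : ι} {p : ι →₀ ℚ}
    (hp : Generic k (Plane.swap i j '' T) p) : Generic k T (swapMap i j p) := by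
  refine ⟨?_, fun h hh hsk => hp.2 _ ⟨h, hh, rfl⟩ (hsk.swap i j)⟩
  rw [← hp.1]
  exact LinearMap.congr_fun (total_comp_swapMap i j) p

theorem balanced_of_inSg {n k l : ℕ} {X : Set (Alg ι n)}
    (hX : ∀ x ∈ X, Balanced k l (x : C ι)) {x : Alg ι n} (hx : InSg ι X x) :
    Balanced k l (x : C ι) := by
  induction hx with
  | basic h => exact hX _ h
  | bot => exact ⟨∅, Set.finite_empty, fun _ _ _ _ => Iff.rfl⟩
  | sup _ _ h₁ h₂ =>
    obtain ⟨T, fT, dT⟩ := h₁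
    obtain ⟨S, fS, dS⟩ := h₂
    exact ⟨T ∪ S, fT.union fS, fun p q hp hq => or_congr
      (dT p q (hp.mono Set.subset_union_left) (hq.mono Set.subset_union_left))
      (dS p q (hp.mono Set.subset_union_right) (hq.mono Set.subset_union_right))⟩
  | compl _ h =>
    obtain ⟨T, fT, dT⟩ := h
    exact ⟨T, fT, fun p q hp hq => not_congr (dT p q hp hq)⟩
  -- No induction hypothesis is needed: x is determined by finitely many planes, and its cylinder by
  -- planes that are zero or skew.
  | @cyl i x _ _ =>
    obtain ⟨T, -, fT, dT⟩ := good_of_inSg x.2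
    exact (dT.cyl fT i).balanced (eliminate_finite i fT) fun h hh =>
      Plane.eq_zero_or_skew (coeff_of_mem_eliminate hh)
  | diag i j =>
    refine (determines_diag i j).balanced (Set.finite_singleton _) ?_
    rintro _ rfl
    exact diagPlane_eq_zero_or_skew i j
  | @subst i j x _ h =>
    obtain ⟨T, fT, dT⟩ := h
    refine ⟨_, fT.image (Plane.swap i j), fun p q hp hq => ?_⟩
    exact (toV_mem_subst i j x.1 p).trans
      ((dT _ _ hp.swapMap hq.swapMap).trans (toV_mem_subst i j x.1 q).symm)

/-- All sufficiently generic points of `total = k` lie in `X`. -/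
def GenericallyMem (k : ℕ) (X : C ι) : Prop :=
  ∃ T : Set (Plane ι), T.Finite ∧ ∀ p, Generic k T p → toV p ∈ X

/-- By the zero-one law, if X does not contain the generic points of a level, it contains none of
them. Thus one truth value per level records all that matters for balance. -/
theorem Good.balanced {n k l : ℕ} {X : C ι} (hX : Good n X)
    (h : GenericallyMem k X ↔ GenericallyMem l X) : Balanced k l X := by
  by_cases hk : GenericallyMem k X
  · obtain ⟨T, fT, dT⟩ := hk
    obtain ⟨S, fS, dS⟩ := h.1 ⟨T, fT, dT⟩
    exact ⟨T ∪ S, fT.union fS, fun p q hp hq => iff_of_true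
      (dT p (hp.mono Set.subset_union_left)) (dS q (hq.mono Set.subset_union_right))⟩
  · obtain ⟨T, hT, fT, dT⟩ := hX
    have notMem : ∀ m, ¬ GenericallyMem m X → ∀ p, Generic m T p → toV p ∉ X := by
      intro m hm p hp hpX
      exact hm ⟨T, fT, fun q hq => (dT.iff_of_generic hT hp hq).1 hpX⟩
    exact ⟨T, fT, fun p q hp hq => iff_of_false (notMem k hk p hp)
      (notMem l (fun hl => hk (h.2 hl)) q hq)⟩

theorem not_balanced_a [Nonempty ι] {k l : ℕ} (hkl : k ≠ l) : ¬ Balanced k l (a ι k) := by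
  rintro ⟨T, fT, dT⟩
  obtain ⟨p, hp⟩ := exists_generic k fT
  obtain ⟨q, hq⟩ := exists_generic l fT
  have := dT p q hp hq
  rw [toV_mem_a, toV_mem_a, hp.1, hq.1] at this
  exact hkl (by exact_mod_cast (this.1 rfl).symm)

theorem a_mem_subalg {n k : ℕ} (hk : k < 2 ^ n) : InSg ι {x | ∃ k < 2 ^ n, x = a ι k} (a ι k) :=
  InSg.basic ⟨k, hk, rfl⟩

theorem Balanced.symm {k l : ℕ} {X : C ι} (h : Balanced k l X) : Balanced l k X := by
  obtain ⟨T, fT, dT⟩ := h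
  exact ⟨T, fT, fun p q hp hq => (dT q p hq hp).symm⟩

theorem not_generates_of_encard_le [Nonempty ι] {n : ℕ} {X : Set (Alg ι n)}
    (hX : X.encard ≤ n) : ¬ Generates ι X := by
  classical
  intro hgen
  have fX : X.Finite := Set.finite_of_encard_le_coe hX
  have hcard : fX.toFinset.card ≤ n := by
    rw [fX.encard_eq_coe_toFinset_card] at hX
    exact_mod_cast hX
  obtain ⟨k, hk, l, hl, hkl, heq⟩ := Finset.exists_ne_map_eq_of_card_lt_of_maps_to
    -- Level 2 ^ n is included although its plane is not a generator: it makes the levels outnumber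
    -- the at most 2 ^ n patterns of generic membership.
    (s := Finset.range (2 ^ n + 1)) (t := fX.toFinset.powerset)
    (f := fun k => fX.toFinset.filter fun x => GenericallyMem k (x : C ι))
    (by
      rw [Finset.card_powerset, Finset.card_range]
      exact Nat.lt_succ_of_le (Nat.pow_le_pow_right two_pos hcard))
    (fun k _ => Finset.mem_powerset.2 (Finset.filter_subset _ _))
  have hbal : ∀ x : Alg ι n, Balanced k l (x : C ι) := by
    refine fun x => balanced_of_inSg (fun y hy => (good_of_inSg y.2).balanced ?_) (hgen x)
    have := Finset.ext_iff.1 heq y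
    simpa [hy] using this
  rw [Finset.mem_range] at hk hl
  -- The smaller of the two levels is below 2 ^ n, so its plane belongs to the algebra.
  rcases lt_or_gt_of_ne hkl with h | h
  · exact not_balanced_a hkl (hbal ⟨a ι k, a_mem_subalg (by omega)⟩)
  · exact not_balanced_a hkl.symm (hbal ⟨a ι l, a_mem_subalg (by omega)⟩).symm

end LowerBound

/-! ### Generation by n + 1 elements -/

section UpperBound

variable {ι : Type u}

theorem InSg.trans {A : Type v} [BooleanAlgebra A] [Ops ι A] {X Y : Set A}
    (hXY : ∀ x ∈ X, InSg ι Y x) {x : A} (hx : InSg ι X x) : InSg ι Y x := by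
  induction hx with
  | basic h => exact hXY _ h
  | bot => exact .bot
  | sup _ _ h₁ h₂ => exact .sup h₁ h₂
  | compl _ h => exact .compl h
  | cyl i _ h => exact .cyl i h
  | diag i j => exact .diag i j
  | subst i j _ h => exact .subst i j h

theorem inSg_finset_sup {A : Type v} [BooleanAlgebra A] [Ops ι A] {X : Set A} {κ : Type*}
    (S : Finset κ) {f : κ → A} (hf : ∀ k ∈ S, InSg ι X (f k)) : InSg ι X (S.sup f) := by
  classical
  induction S using Finset.induction_on with
  | empty => exact .bot
  | insert k S _ ih =>
    rw [Finset.sup_insert]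
    exact .sup (hf k (Finset.mem_insert_self k S))
      (ih fun j hj => hf j (Finset.mem_insert_of_mem hj))

theorem inSg_finset_inf {A : Type v} [BooleanAlgebra A] [Ops ι A] {X : Set A} {κ : Type*}
    (S : Finset κ) {f : κ → A} (hf : ∀ k ∈ S, InSg ι X (f k)) : InSg ι X (S.inf f) := by
  have := (inSg_finset_sup S fun k hk => (hf k hk).compl).compl
  rwa [Finset.compl_sup, show (fun k => (f k)ᶜᶜ) = f from funext fun k => compl_compl _] at this

/-- Generation inside a subalgebra. -/
theorem Subalgebra.inSg_of_inSg {A : Type v} [BooleanAlgebra A] [Ops ι A] (S : Subalgebra ι A)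
    {Y : Set A} (hY : ∀ y ∈ Y, y ∈ S.toBooleanSubalgebra) {x : A} (hx : InSg ι Y x) :
    ∃ h : x ∈ S.toBooleanSubalgebra, InSg ι {z : S.Carrier | z.1 ∈ Y} (⟨x, h⟩ : S.Carrier) := by
  induction hx with
  | basic h => exact ⟨hY _ h, .basic h⟩
  | bot => exact ⟨_, .bot⟩
  | sup _ _ h₁ h₂ =>
    obtain ⟨_, h₁⟩ := h₁
    obtain ⟨_, h₂⟩ := h₂
    exact ⟨_, .sup h₁ h₂⟩
  | compl _ h => obtain ⟨_, h⟩ := h; exact ⟨_, .compl h⟩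
  | cyl i _ h => obtain ⟨_, h⟩ := h; exact ⟨_, .cyl i h⟩
  | diag i j => exact ⟨_, .diag i j⟩
  | subst i j _ h => obtain ⟨_, h⟩ := h; exact ⟨_, .subst i j h⟩

/-- The union of the `a_k`, `k < 2 ^ n`, for which `k + 2 ^ n` has `j`-th binary digit `1`. -/
noncomputable def digitSet (ι : Type u) (n j : ℕ) : C ι :=
  ((Finset.range (2 ^ n)).filter fun k => (k + 2 ^ n).testBit j).sup (a ι)

theorem toV_mem_digitSet {n j : ℕ} {s : ι →₀ ℚ} :
    toV s ∈ digitSet ι n j ↔ ∃ k : ℕ, k < 2 ^ n ∧ (k + 2 ^ n).testBit j ∧ total ι s = k := by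
  simp [digitSet, Finset.sup_set_eq_biUnion, toV_mem_a, and_assoc]

theorem digitSet_injOn [Nonempty ι] (n : ℕ) :
    Set.InjOn (digitSet ι n) (Finset.range (n + 1) : Set ℕ) := by
  obtain ⟨i⟩ := ‹Nonempty ι›
  have mem : ∀ k : ℕ, k < 2 ^ n → ∀ j, toV (Finsupp.single i (k : ℚ)) ∈ digitSet ι n j ↔
      (k + 2 ^ n).testBit j := by
    intro k hk j
    rw [toV_mem_digitSet, total_single]
    constructor
    · rintro ⟨k', -, h, e⟩
      rwa [Nat.cast_injective e]
    · exact fun h => ⟨k, hk, h, rfl⟩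
  have key : ∀ j l, j < l → l ≤ n → digitSet ι n j ≠ digitSet ι n l := by
    intro j l hjl hl heq
    have hj : j < n := hjl.trans_le hl
    have H := fun k hk => (mem k hk j).symm.trans ((Set.ext_iff.1 heq _).trans (mem k hk l))
    rcases hl.lt_or_eq with hln | rfl
    -- The code 2 ^ l + 2 ^ n has digit l but not digit j. For l = n, the code of 0 plays this role.
    · have := H (2 ^ l) (Nat.pow_lt_pow_right one_lt_two hln)
      rw [add_comm, Nat.testBit_two_pow_add_gt hln, Nat.testBit_two_pow_add_gt hj] at this
      simp [hjl.ne'] at this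
    · have := H 0 (by positivity)
      simp [hjl.ne'] at this
  intro j hj l hl heq
  simp only [Finset.coe_range, Set.mem_Iio] at hj hl
  by_contra hne
  rcases lt_or_gt_of_ne hne with h | h
  · exact key j l h (by omega) heq
  · exact key l j h (by omega) heq.symm

/-- Adding 2 ^ n makes every code nonzero, with leading digit n. The all-zero code is left to the
points on none of the planes, so n + 1 digits tell these points and all the levels apart. -/
theorem a_eq_inf_digitSet {n k : ℕ} (hk : k < 2 ^ n) :
    a ι k = (Finset.range (n + 1)).inf fun j =>
      if (k + 2 ^ n).testBit j then digitSet ι n j else (digitSet ι n j)ᶜ := by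
  refine set_ext fun s => ?_
  have e : toV s ∈ ((Finset.range (n + 1)).inf fun j =>
      if (k + 2 ^ n).testBit j then digitSet ι n j else (digitSet ι n j)ᶜ) ↔
      ∀ j < n + 1, ((k + 2 ^ n).testBit j ↔ toV s ∈ digitSet ι n j) := by
    simp only [Finset.inf_set_eq_iInter, Set.mem_iInter, Finset.mem_range]
    refine forall₂_congr fun j _ => ?_
    split_ifs with h <;> simp [h]
  rw [e, toV_mem_a]
  constructor
  · intro hs j _
    rw [toV_mem_digitSet]
    constructor
    · exact fun h => ⟨k, hk, h, hs⟩
    · rintro ⟨k', -, h, e'⟩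
      rwa [Nat.cast_injective (hs.symm.trans e')]
  · intro h
    have hn : (k + 2 ^ n).testBit n := by
      rw [add_comm, Nat.testBit_two_pow_add_eq, Nat.testBit_lt_two_pow hk]
      rfl
    obtain ⟨k', hk', -, e'⟩ := toV_mem_digitSet.1 ((h n (by omega)).1 hn)
    rw [e']
    have hbit : k + 2 ^ n = k' + 2 ^ n := by
      refine Nat.eq_of_testBit_eq fun j => ?_
      by_cases hj : j < n + 1
      · rw [Bool.eq_iff_iff, h j hj, toV_mem_digitSet]
        constructor
        · rintro ⟨k₁, -, h₁, e₁⟩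
          rwa [Nat.cast_injective (e'.symm.trans e₁)]
        · exact fun h₁ => ⟨k', hk', h₁, e'⟩
      · have hle : 2 ^ (n + 1) ≤ 2 ^ j := Nat.pow_le_pow_right two_pos (by omega)
        rw [pow_succ] at hle
        rw [Nat.testBit_lt_two_pow (by omega), Nat.testBit_lt_two_pow (by omega)]
    rw [Nat.add_right_cancel hbit]

theorem exists_generates [Nonempty ι] (n : ℕ) :
    ∃ X : Set (Alg ι n), X.encard = n + 1 ∧ Generates ι X := by
  set Y : Set (C ι) := digitSet ι n '' (Finset.range (n + 1) : Set ℕ) with hYdef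
  have hY : ∀ y ∈ Y, y ∈ (subalg ι n).toBooleanSubalgebra := by
    rintro _ ⟨j, -, rfl⟩
    exact inSg_finset_sup _ fun k hk =>
      a_mem_subalg (Finset.mem_range.1 (Finset.mem_filter.1 hk).1)
  refine ⟨{z | z.1 ∈ Y}, ?_, fun x => ?_⟩
  · have : {z : Alg ι n | z.1 ∈ Y} = Subtype.val ⁻¹' Y := rfl
    rw [this, Set.encard_preimage_of_injective_subset_range Subtype.val_injective
      (fun y hy => ⟨⟨y, hY y hy⟩, rfl⟩), hYdef, (digitSet_injOn n).encard_image,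
      Set.encard_coe_eq_coe_finsetCard, Finset.card_range]
    rfl
  · have hx : InSg ι Y x.1 := by
      refine InSg.trans ?_ x.2
      rintro _ ⟨k, hk, rfl⟩
      rw [a_eq_inf_digitSet hk]
      refine inSg_finset_inf _ fun j hj => ?_
      have hb : InSg ι Y (digitSet ι n j) := .basic ⟨j, hj, rfl⟩
      split_ifs
      · exact hb
      · exact hb.compl
    exact ((subalg ι n).inSg_of_inSg hY hx).2

end UpperBound

/-! ### Representation over an ultrapower of the rationals -/

section Representation

open Filter

variable (ι : Type u)

/-- An ultrafilter on the finite subsets of `ι` that contains every `{Δ | Γ ⊆ Δ}`. -/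
noncomputable def finsetUltrafilter : Ultrafilter (Finset ι) := Ultrafilter.of atTop

theorem eventually_mem (i : ι) : ∀ᶠ Δ in (finsetUltrafilter ι : Filter (Finset ι)), i ∈ Δ :=
  Ultrafilter.of_le atTop
    ((eventually_ge_atTop {i}).mono fun _ h => Finset.singleton_subset_iff.1 h)

/-- The ultrapower of `ℚ` along `finsetUltrafilter`. -/
abbrev UltraRat : Type u := Germ (finsetUltrafilter ι : Filter (Finset ι)) ℚ

variable {ι}

theorem out_coe_eventuallyEq (f : Finset ι → ℚ) :
    ∀ᶠ Δ in (finsetUltrafilter ι : Filter (Finset ι)),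
      Quotient.out (f : UltraRat ι) Δ = f Δ :=
  Germ.coe_eq.1 (Quotient.out_eq (f : UltraRat ι))

open Classical in
/-- The `Δ`-th coordinate of a sequence of ultrarationals, truncated to the index set `Δ`. -/
noncomputable def truncate (s : ι → UltraRat ι) (Δ : Finset ι) : V ι :=
  ⟨fun i => if i ∈ Δ then Quotient.out (s i) Δ else 0,
    Δ.finite_toSet.subset fun i hi => by
      by_contra h
      exact hi (if_neg h)⟩

/-- The representation of the set algebra on the weak space `V` over the ultrapower. -/
def ultraRep (X : C ι) : Set (Set.univ : Set (ι → UltraRat ι)) :=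
  {s | ∀ᶠ Δ in (finsetUltrafilter ι : Filter (Finset ι)), truncate s.1 Δ ∈ X}

theorem ultraRep_cyl (i : ι) (X : C ι) : ultraRep (Ops.cyl i X) = Ops.cyl i (ultraRep X) := by
  classical
  ext ⟨s, -⟩
  constructor
  · intro h
    have h' : ∀ Δ, ∃ t : V ι, truncate s Δ ∈ (Ops.cyl i X : C ι) →
        t ∈ X ∧ ∀ j, j ≠ i → t.1 j = (truncate s Δ).1 j := by
      intro Δ
      by_cases hΔ : truncate s Δ ∈ (Ops.cyl i X : C ι)
      · obtain ⟨t, ht⟩ := hΔ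
        exact ⟨t, fun _ => ht⟩
      · exact ⟨truncate s Δ, fun h => absurd h hΔ⟩
    choose t ht using h'
    let q : Finset ι → ℚ := fun Δ => (t Δ).1 i
    refine ⟨⟨Function.update s i (q : UltraRat ι), trivial⟩, ?_, fun j hj =>
      Function.update_of_ne hj _ _⟩
    have h₀ : ∀ᶠ Δ in (finsetUltrafilter ι : Filter (Finset ι)),
      truncate s Δ ∈ (Ops.cyl i X : C ι) := h
    show ∀ᶠ Δ in (finsetUltrafilter ι : Filter (Finset ι)), _
    -- The witnesses' i-th coordinates form one germ q. For almost all Δ its chosen representative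
    -- agrees with q at Δ, and i ∈ Δ, so truncation keeps it.
    filter_upwards [h₀, out_coe_eventuallyEq q, eventually_mem ι i] with Δ h₁ h₂ h₃
    obtain ⟨hX, hoff⟩ := ht Δ h₁
    convert hX using 1
    refine Subtype.ext (funext fun j => ?_)
    by_cases hj : j = i
    · subst hj
      simp [truncate, h₃, h₂, q]
    · rw [hoff j hj]
      simp [truncate, hj]
  · rintro ⟨⟨t, _⟩, ht, hts⟩
    refine Eventually.mono ht fun Δ hΔ => ⟨_, hΔ, fun j hj => ?_⟩
    have : t j = s j := hts j hj
    simp [truncate, this]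

theorem ultraRep_diag (i j : ι) : ultraRep (Ops.diag i j : C ι) = Ops.diag i j := by
  classical
  ext ⟨s, -⟩
  have h : s i = s j ↔ ∀ᶠ Δ in (finsetUltrafilter ι : Filter (Finset ι)),
      Quotient.out (s i) Δ = Quotient.out (s j) Δ := by
    conv_lhs => rw [← Quotient.out_eq (s i), ← Quotient.out_eq (s j)]
    exact Germ.coe_eq
  refine Iff.trans (eventually_congr ?_) h.symm
  filter_upwards [eventually_mem ι i, eventually_mem ι j] with Δ hi hj
  show (truncate s Δ).1 i = (truncate s Δ).1 j ↔ _
  simp [truncate, hi, hj]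

theorem ultraRep_subst (i j : ι) (X : C ι) :
    ultraRep (Ops.subst i j X) = Ops.subst i j (ultraRep X) := by
  classical
  ext ⟨s, -⟩
  have key : ∀ᶠ Δ in (finsetUltrafilter ι : Filter (Finset ι)),
      (truncate (s ∘ Equiv.swap i j) Δ).1 = (truncate s Δ).1 ∘ Equiv.swap i j := by
    -- A set Δ containing both i and j is invariant under their transposition, so truncation to Δ
    -- commutes with it.
    filter_upwards [eventually_mem ι i, eventually_mem ι j] with Δ hi hj
    funext k
    have : Equiv.swap i j k ∈ Δ ↔ k ∈ Δ := by
      rcases eq_or_ne k i with rfl | hki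
      · simp [hi, hj]
      rcases eq_or_ne k j with rfl | hkj
      · simp [hi, hj]
      rw [Equiv.swap_apply_of_ne_of_ne hki hkj]
    simp [truncate, this]
  have h₁ : (⟨s, trivial⟩ : (Set.univ : Set (ι → UltraRat ι))) ∈ ultraRep (Ops.subst i j X) ↔
      ∀ᶠ Δ in (finsetUltrafilter ι : Filter (Finset ι)),
        truncate (s ∘ Equiv.swap i j) Δ ∈ X := by
    refine eventually_congr (key.mono fun Δ hΔ => ?_)
    constructor
    · rintro ⟨t, ht, hts⟩
      have : truncate (s ∘ Equiv.swap i j) Δ = t :=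
        Subtype.ext (hΔ.trans (by convert hts.symm))
      rwa [this]
    · exact fun h => ⟨_, h, by convert hΔ⟩
  refine h₁.trans ⟨fun h => ⟨⟨s ∘ Equiv.swap i j, trivial⟩, h, by dsimp only⟩, ?_⟩
  rintro ⟨⟨t, _⟩, ht, hts⟩
  have : t = s ∘ Equiv.swap i j := by convert hts
  rw [← this]
  exact ht

theorem isHom_ultraRep (n : ℕ) :
    IsHom ι (fun (x : Alg ι n) (_ : PUnit.{u + 1}) => ultraRep (x : C ι)) where
  bot := funext fun _ => Set.ext fun _ => by
    show (∀ᶠ _ in (finsetUltrafilter ι : Filter (Finset ι)), False) ↔ False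
    exact iff_of_false (NeBot.ne' ∘ eventually_false_iff_eq_bot.1) id
  top := funext fun _ => Set.ext fun _ => by
    show (∀ᶠ _ in _, True) ↔ True
    simp
  sup _ _ := funext fun _ => Set.ext fun _ => Ultrafilter.eventually_or
  inf _ _ := funext fun _ => Set.ext fun _ => eventually_and
  compl _ := funext fun _ => Set.ext fun _ => Ultrafilter.eventually_not
  cyl i x := funext fun _ => ultraRep_cyl i x.1
  diag i j := funext fun _ => ultraRep_diag i j
  subst i j x := funext fun _ => ultraRep_subst i j x.1

theorem isRepresentable_alg (ι : Type u) (n : ℕ) : IsRepresentable ι (Alg ι n) := by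
  have : Nonempty (Set.univ : Set (ι → UltraRat ι)) :=
    ⟨⟨fun _ => ((0 : ℚ) : UltraRat ι), trivial⟩⟩
  exact ⟨PUnit, fun _ => UltraRat ι, _, isHom_ultraRep n,
    (isSimple_alg ι n).injective_of_isHom (isHom_ultraRep n)⟩

end Representation

end QEA

theorem theorem2 (α : Ordinal.{u}) (hα : 0 < α) :
    (∀ n : ℕ,
      QEA.IsSimple α.ToType (QEA.Alg α.ToType n) ∧
      (¬ ∃ X : Set (QEA.Alg α.ToType n),
        X.encard ≤ n ∧ QEA.Generates α.ToType X) ∧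
      (∃ X : Set (QEA.Alg α.ToType n),
        X.encard = n + 1 ∧ QEA.Generates α.ToType X)) ∧
    (∃ (A : Type u) (_ : BooleanAlgebra A) (_ : QEA.Ops α.ToType A),
      QEA.IsRepresentable α.ToType A ∧
      QEA.IsSimple α.ToType A ∧
      (∃ X : Set A, X.Finite ∧ QEA.Generates α.ToType X) ∧
      ¬ ∃ x : A, QEA.Generates α.ToType ({x} : Set A)) := by
  have : Nonempty α.ToType := Ordinal.nonempty_toType_iff.2 hα.ne'
  refine ⟨fun n => ⟨QEA.isSimple_alg _ n, ?_, QEA.exists_generates n⟩,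
    -- For n = 1 the bounds say that two elements generate the algebra but no single one does.
    QEA.Alg α.ToType 1, inferInstance, inferInstance, QEA.isRepresentable_alg _ 1,
    QEA.isSimple_alg _ 1, ?_, ?_⟩
  · rintro ⟨X, hX, hgen⟩
    exact QEA.not_generates_of_encard_le hX hgen
  · obtain ⟨X, hX, hgen⟩ := QEA.exists_generates (ι := α.ToType) 1
    exact ⟨X, Set.finite_of_encard_eq_coe (k := 2) (by rw [hX]; norm_num), hgen⟩
  · rintro ⟨x, hgen⟩
    exact QEA.not_generates_of_encard_le (by simp) hgen
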